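/- Let $G=(V,E)$ be a finite simple triangle-free graph with a weight function $w:E\to\mathbb{R}_{\ge 0}$, let $\Delta\ge 0$ be an integer, and suppose that every vertex of $G$ has degree at most $\Delta$. Write $w(G)=\sum_{e\in E}w(e)$, and let $$\mathrm{mac}(G)=\max_{A\subseteq V}\ \sum_{\substack{uv\in E\\ u\in A,\ v\in V\setminus A}} w(uv)$$ be the maximum weight of a cut of $G$. Then $$\mathrm{mac}(G)\ \ge\ t_\Delta\cdot w(G),\qquad\text{where}\quad t_\Delta=\frac12+\frac{3\Delta-1}{4\Delta^2+2\Delta-2}.$$ -/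

import Mathlib

namespace WeightedCut

open Classical in
/-- The weight `w(H)` of a graph `H` on a finite vertex set: the sum of `w e` over the edges `e`
of `H`. Only the values of `w` on edges matter. -/
noncomputable def weight {V : Type*} [Fintype V] (w : Sym2 V → ℝ) (H : SimpleGraph V) : ℝ :=
  ∑ e ∈ H.edgeFinset, w e

/-- The cut `(A, B)` of `G` with `B = V \ A`: the bipartite (spanning) subgraph of `G` formed by
the edges of `G` between `A` and `B`. -/
def cut {V : Type*} (G : SimpleGraph V) (A : Set V) : SimpleGraph V :=
  G.between A Aᶜ

/-- `mac(G)`: the maximum weight of a cut of `G`, over all bipartitions `(A, V \ A)` of the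
finite vertex set. One side may be empty, so that graphs with at most one vertex have a cut. -/
noncomputable def mac {V : Type*} [Fintype V] (G : SimpleGraph V) (w : Sym2 V → ℝ) : ℝ :=
  (Finset.univ : Finset (Finset V)).sup' Finset.univ_nonempty
    (fun A => weight w (cut G (A : Set V)))

end WeightedCut

/-! Partition the vertices into parts inducing bipartite graphs, 2-colour each part, and flip every
part by an independent fair coin. Edges inside parts are always cut and every other edge with
probability 1/2, so the maximum cut is at least half of `w(G)` plus the weight inside the parts
(`weight_add_inside_le_two_mul_mac`).

For `Δ ≥ 2` the parts come from two matchings. Vizing's theorem splits `E` into `Δ + 1` matchings,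
so one has weight `M ≥ w(G) / (Δ + 1)`. Contracting it leaves degrees at most `2Δ - 2`, so Vizing
again gives a matching in the contraction of weight `N ≥ (w(G) - M) / (2Δ - 1)`. The parts obtained
from both contractions have at most four vertices and are bipartite because `G` has no triangle
(`exists_bool_of_two_contractions`). Combining, `M + N ≥ (3Δ - 1) / ((2Δ - 1)(Δ + 1)) * w(G)`, which
is twice the excess of `t_Δ` over 1/2.

Vizing's theorem is proved with fans and Kempe swaps, colouring one more edge at a time. -/

/-- A partial proper edge colouring: edges with a common end get different colours. -/
def IsProperPartial {V α : Type*} (c : Sym2 V → Option α) : Prop :=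
  ∀ ⦃x v u w⦄, c s(v, u) = some x → c s(v, w) = some x → u = w

/-- The colour `x` is missing at the vertex `v`. -/
def Missing {V α : Type*} (c : Sym2 V → Option α) (v : V) (x : α) : Prop :=
  ∀ u, c s(v, u) ≠ some x

/-- In a graph of maximum degree two, three vertices of degree at most one do not lie in one
component. -/
theorem SimpleGraph.not_reachable_of_degree_le {V : Type*} [Fintype V] (K : SimpleGraph V)
    (hK : ∀ v, (K.neighborSet v).ncard ≤ 2) {x y z : V} (hxy : x ≠ y) (hxz : x ≠ z) (hyz : y ≠ z)
    (hx : (K.neighborSet x).ncard ≤ 1) (hy : (K.neighborSet y).ncard ≤ 1)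
    (hz : (K.neighborSet z).ncard ≤ 1) (h1 : K.Reachable x y) (h2 : K.Reachable x z) : False := by
  classical
  let C := K.connectedComponentMk x
  have hconn : C.toSimpleGraph.Connected := C.connected_toSimpleGraph
  have hcard := hconn.card_vert_le_card_edgeSet_add_one
  have hsum := C.toSimpleGraph.sum_degrees_eq_twice_card_edges
  have hdeg : ∀ v : C, C.toSimpleGraph.degree v ≤ (K.neighborSet v).ncard := by
    intro v
    rw [← SimpleGraph.card_neighborFinset_eq_degree, ← Set.ncard_coe_finset,
      ← Set.ncard_image_of_injective _ Subtype.val_injective]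
    refine Set.ncard_le_ncard ?_ (Set.toFinite _)
    rintro _ ⟨u, hu, rfl⟩
    rw [Finset.mem_coe, SimpleGraph.mem_neighborFinset] at hu
    exact hu
  have hxC : x ∈ C := rfl
  have hyC : y ∈ C := SimpleGraph.ConnectedComponent.sound h1.symm
  have hzC : z ∈ C := SimpleGraph.ConnectedComponent.sound h2.symm
  let T : Finset C := {⟨x, hxC⟩, ⟨y, hyC⟩, ⟨z, hzC⟩}
  have hT : T.card = 3 := by
    apply Finset.card_eq_three.2
    exact ⟨_, _, _, by simpa using hxy, by simpa using hxz, by simpa using hyz, rfl⟩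
  -- On `n` vertices connectedness forces degree sum at least `2n - 2`, while the three low degrees
  -- leave at most `2n - 3`.
  have hbound : ∑ v : C, (C.toSimpleGraph.degree v + if v ∈ T then 1 else 0)
      ≤ ∑ _v : C, 2 := by
    refine Finset.sum_le_sum fun v _ => ?_
    have h := hdeg v
    split_ifs with hv
    · have : (K.neighborSet v).ncard ≤ 1 := by
        simp only [T, Finset.mem_insert, Finset.mem_singleton] at hv
        rcases hv with rfl | rfl | rfl <;> assumption
      omega
    · have := hK v
      omega
  rw [Finset.sum_add_distrib, hsum, Finset.sum_ite_mem, Finset.univ_inter, Finset.sum_const,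
    Finset.sum_const, hT, Finset.card_univ] at hbound
  rw [Nat.card_eq_fintype_card, Nat.card_eq_fintype_card, ← SimpleGraph.edgeFinset_card] at hcard
  simp only [smul_eq_mul] at hbound
  omega

/-! ### Kempe chains and colour exchange. -/

section Kempe

variable {V α : Type*}

/-- The subgraph of edges coloured `a` or `b`. -/
def kempeGraph (c : Sym2 V → Option α) (a b : α) : SimpleGraph V :=
  SimpleGraph.fromEdgeSet {e | c e = some a ∨ c e = some b}

open Classical in
/-- Exchange the colours `a` and `b` on the Kempe component of `x`. -/
noncomputable def kempeSwap (c : Sym2 V → Option α) (a b : α) (x : V) : Sym2 V → Option α :=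
  fun e => if ∃ u ∈ e, (kempeGraph c a b).Reachable x u then (c e).map (Equiv.swap a b) else c e

variable {c : Sym2 V → Option α} {a b : α} {x : V}

open Classical in
theorem kempeSwap_of_reachable {u : V} (h : (kempeGraph c a b).Reachable x u) (w : V) :
    kempeSwap c a b x s(u, w) = (c s(u, w)).map (Equiv.swap a b) :=
  if_pos ⟨u, by simp, h⟩

/-- An edge leaving the component has neither colour `a` nor `b`, so exchanging them does not affect
it. -/
theorem kempeSwap_of_not_reachable {u : V} (h : ¬ (kempeGraph c a b).Reachable x u) (w : V) :
    kempeSwap c a b x s(u, w) = c s(u, w) := by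
  classical
  unfold kempeSwap
  split_ifs with hr
  · obtain ⟨t, ht, hr⟩ := hr
    rcases Sym2.mem_iff.1 ht with rfl | rfl
    · exact absurd hr h
    · have hne : t ≠ u := by rintro rfl; exact h hr
      have hnot : ¬ (c s(u, t) = some a ∨ c s(u, t) = some b) := fun hc =>
        h (hr.trans (SimpleGraph.Adj.reachable (by
          rw [kempeGraph, SimpleGraph.fromEdgeSet_adj, Sym2.eq_swap]
          exact ⟨hc, hne⟩)))
      cases hc : c s(u, t) with
      | none => rfl
      | some y =>
        rw [hc] at hnot
        simp only [Option.some.injEq, not_or] at hnot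
        simp [Equiv.swap_apply_of_ne_of_ne hnot.1 hnot.2]
  · rfl

theorem kempeSwap_eq_none_iff (e : Sym2 V) : kempeSwap c a b x e = none ↔ c e = none := by
  classical
  unfold kempeSwap
  split_ifs <;> simp

theorem kempeSwap_missing_of_reachable {u : V} (h : (kempeGraph c a b).Reachable x u) (y : α)
    [DecidableEq α] :
    Missing (kempeSwap c a b x) u y ↔ Missing c u (Equiv.swap a b y) := by
  refine forall_congr' fun w => not_congr ?_
  rw [kempeSwap_of_reachable h]
  cases c s(u, w) with
  | none => simp
  | some t =>
    simp only [Option.map_some, Option.some.injEq]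
    rw [← Equiv.swap_apply_eq_iff]
    convert Iff.rfl

theorem kempeSwap_missing_of_not_reachable {u : V} (h : ¬ (kempeGraph c a b).Reachable x u)
    (y : α) : Missing (kempeSwap c a b x) u y ↔ Missing c u y := by
  simp only [Missing, kempeSwap_of_not_reachable h]

theorem IsProperPartial.swap (hc : IsProperPartial c) :
    IsProperPartial (kempeSwap c a b x) := by
  classical
  intro y v u w h1 h2
  by_cases h : (kempeGraph c a b).Reachable x v
  · rw [kempeSwap_of_reachable h, Option.map_eq_some_iff] at h1 h2
    obtain ⟨p, hp, hp'⟩ := h1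
    obtain ⟨q, hq, hq'⟩ := h2
    have : p = q := (Equiv.swap a b).injective (hp'.trans hq'.symm)
    subst this
    exact hc hp hq
  · rw [kempeSwap_of_not_reachable h] at h1 h2
    exact hc h1 h2

theorem IsProperPartial.ncard_kempeGraph_neighborSet_le (hc : IsProperPartial c) (v : V) :
    ((kempeGraph c a b).neighborSet v).ncard ≤ 2 := by
  refine (Set.ncard_le_ncard_of_injOn (t := {some a, some b}) (fun w => c s(v, w)) ?_ ?_
    (Set.toFinite _)).trans ((Set.ncard_insert_le _ _).trans (by simp))
  · intro w hw
    exact ((SimpleGraph.fromEdgeSet_adj _).1 hw).1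
  · intro w hw u _ h
    rcases ((SimpleGraph.fromEdgeSet_adj _).1 hw).1 with hw | hw
    · exact hc hw (h.symm.trans hw)
    · exact hc hw (h.symm.trans hw)

theorem IsProperPartial.ncard_kempeGraph_neighborSet_le_one (hc : IsProperPartial c) {v : V}
    (h : Missing c v a ∨ Missing c v b) : ((kempeGraph c a b).neighborSet v).ncard ≤ 1 := by
  have key : ((kempeGraph c a b).neighborSet v).Subsingleton := by
    intro w hw u hu
    have hw := ((SimpleGraph.fromEdgeSet_adj _).1 hw).1
    have hu := ((SimpleGraph.fromEdgeSet_adj _).1 hu).1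
    rcases h with h | h
    · exact hc (hw.resolve_left (h w)) (hu.resolve_left (h u))
    · exact hc (hw.resolve_right (h w)) (hu.resolve_right (h u))
  rcases key.eq_empty_or_singleton with h | ⟨u, h⟩ <;> simp [h]

end Kempe

theorem List.IsChain.imp_of_mem_tail {β : Type*} {R S : β → β → Prop} {l : List β}
    (h : l.IsChain R) (hRS : ∀ p ∈ l, ∀ q ∈ l.tail, R p q → S p q) : l.IsChain S := by
  rw [List.isChain_iff_getElem] at h ⊢
  intro i hi
  refine hRS _ (List.getElem_mem _) _ ?_ (h i hi)
  have hi' : i < l.tail.length := by rw [List.length_tail]; omega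
  have := List.getElem_mem hi'
  rwa [List.getElem_tail] at this

/-! ### Fans and the extension step of Vizing's theorem. -/

section Fan

variable {V α : Type*} {c : Sym2 V → Option α} {v : V}

/-- Consecutive vertices of a fan at `v`: the colour of `vq` is missing at `p`. -/
def FanRel (c : Sym2 V → Option α) (v p q : V) : Prop :=
  ∃ x, c s(v, q) = some x ∧ Missing c p x

open Classical in
theorem IsProperPartial.update_some (hc : IsProperPartial c) {w : V} {x : α}
    (hv : Missing c v x) (hw : Missing c w x) :
    IsProperPartial (Function.update c s(v, w) (some x)) := by
  have key : ∀ {y p q r}, s(p, q) = s(v, w) →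
      Function.update c s(v, w) (some x) s(p, q) = some y →
      Function.update c s(v, w) (some x) s(p, r) = some y → q = r := by
    intro y p q r he h1 h2
    rw [he, Function.update_self, Option.some.injEq] at h1
    subst h1
    by_cases hr : s(p, r) = s(v, w)
    · exact Sym2.congr_right.1 (he.trans hr.symm)
    · rw [Function.update_of_ne hr] at h2
      rcases Sym2.eq_iff.1 he with ⟨rfl, _⟩ | ⟨rfl, _⟩
      · exact absurd h2 (hv r)
      · exact absurd h2 (hw r)
  intro y p q r h1 h2
  by_cases hq : s(p, q) = s(v, w)
  · exact key hq h1 h2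
  by_cases hr : s(p, r) = s(v, w)
  · exact (key hr h2 h1).symm
  · rw [Function.update_of_ne hq] at h1
    rw [Function.update_of_ne hr] at h2
    exact hc h1 h2

open Classical in
theorem IsProperPartial.update_none (hc : IsProperPartial c) (e : Sym2 V) :
    IsProperPartial (Function.update c e none) := by
  have key : ∀ {f y}, Function.update c e none f = some y → c f = some y := by
    intro f y h
    by_cases hf : f = e
    · subst hf; simp at h
    · rwa [Function.update_of_ne hf] at h
  exact fun y p q r h1 h2 => hc (key h1) (key h2)

/-- Shifting the colours along a fan whose last vertex misses a colour missing at the centre. -/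
theorem exists_coloring_of_fan {a : α} (l : List V) : ∀ (w : V) (c : Sym2 V → Option α),
    IsProperPartial c → c s(v, w) = none → v ∉ w :: l → (w :: l).Nodup →
    (w :: l).IsChain (FanRel c v) → Missing c v a →
    Missing c ((w :: l).getLast (List.cons_ne_nil _ _)) a →
    ∃ c' : Sym2 V → Option α, IsProperPartial c' ∧
      ∀ e, c' e = none ↔ c e = none ∧ e ≠ s(v, w) := by
  classical
  induction l with
  | nil =>
    intro w c hc hw hv _ _ hva hwa
    refine ⟨Function.update c s(v, w) (some a), hc.update_some hva hwa, fun e => ?_⟩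
    by_cases he : e = s(v, w)
    · simp [he]
    · simp [he]
  | cons u l ih =>
    intro w c hc hw hv hnd hch hva hlast
    rw [List.isChain_cons_cons] at hch
    obtain ⟨⟨x, hux, hwx⟩, hch⟩ := hch
    have huw : u ≠ w := by
      rintro rfl; simp at hnd
    have hne : s(v, u) ≠ s(v, w) := fun h => huw (Sym2.congr_right.1 h)
    -- The colour of `vu` moves to `vw`, so the uncoloured edge becomes `vu`, at the head of a
    -- shorter fan.
    set c₀ := Function.update c s(v, u) none with hc₀
    set c₁ := Function.update c₀ s(v, w) (some x) with hc₁
    have hc₁u : c₁ s(v, u) = none := by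
      rw [hc₁, Function.update_of_ne hne, hc₀, Function.update_self]
    have hc₁of : ∀ e, e ≠ s(v, u) → e ≠ s(v, w) → c₁ e = c e := fun e h1 h2 => by
      rw [hc₁, Function.update_of_ne h2, hc₀, Function.update_of_ne h1]
    have hmiss₀ : ∀ {p y}, Missing c p y → Missing c₀ p y := by
      intro p y h q
      by_cases hq : s(p, q) = s(v, u)
      · rw [hq, hc₀, Function.update_self]; simp
      · rw [hc₀, Function.update_of_ne hq]; exact h q
    have hmiss : ∀ {p y}, p ≠ v → p ≠ w → Missing c p y → Missing c₁ p y := by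
      intro p y hpv hpw h q
      have : s(p, q) ≠ s(v, w) := by
        intro he
        rcases Sym2.eq_iff.1 he with ⟨h, _⟩ | ⟨h, _⟩
        · exact hpv h
        · exact hpw h
      rw [hc₁, Function.update_of_ne this]
      exact hmiss₀ h q
    have hvx : Missing c₀ v x := by
      intro q
      by_cases hq : q = u
      · rw [hq, hc₀, Function.update_self]; simp
      · rw [hc₀, Function.update_of_ne fun h => hq (Sym2.congr_right.1 h)]
        exact fun h => hq (hc h hux)
    have hv₁ : Missing c₁ v a := by
      intro q
      by_cases hq : s(v, q) = s(v, w)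
      · rw [hq, hc₁, Function.update_self]
        intro h
        rw [Option.some.injEq] at h
        exact hva u (h ▸ hux)
      · rw [hc₁, Function.update_of_ne hq]
        exact hmiss₀ hva q
    have hmem : ∀ p ∈ u :: l, p ≠ v ∧ p ≠ w := by
      intro p hp
      refine ⟨?_, ?_⟩
      · rintro rfl; exact hv (List.mem_cons_of_mem _ hp)
      · rintro rfl; exact (List.nodup_cons.1 hnd).1 hp
    have hnd' := (List.nodup_cons.1 hnd).2
    obtain ⟨c', hc', hsupp⟩ := ih u c₁ ((hc.update_none _).update_some hvx (hmiss₀ hwx)) hc₁u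
      (fun h => hv (List.mem_cons_of_mem _ h)) hnd'
      (hch.imp_of_mem_tail fun p hp q hq ⟨y, hy, hpy⟩ => by
        rw [List.tail_cons] at hq
        have hqu : q ≠ u := by rintro rfl; exact (List.nodup_cons.1 hnd').1 hq
        have hqw := (hmem q (List.mem_cons_of_mem _ hq)).2
        refine ⟨y, ?_, hmiss (hmem p hp).1 (hmem p hp).2 hpy⟩
        rw [hc₁of _ (fun h => hqu (Sym2.congr_right.1 h)) (fun h => hqw (Sym2.congr_right.1 h))]
        exact hy)
      hv₁ (by
        rw [List.getLast_cons_cons] at hlast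
        have := hmem _ (List.getLast_mem (List.cons_ne_nil u l))
        exact hmiss this.1 this.2 hlast)
    refine ⟨c', hc', fun e => ?_⟩
    rw [hsupp]
    by_cases h1 : e = s(v, u)
    · simp [h1, hux]
    · by_cases h2 : e = s(v, w)
      · simp [h2, hc₁]
      · simp [h1, h2, hc₁of e h1 h2]

/-- The colours witnessing the chain are neither `a` nor `b`, so the swap preserves where they are
missing. -/
theorem isChain_fanRel_kempeSwap {a b : α} {z : V} {l : List V} (hch : l.IsChain (FanRel c v))
    (hb : ∀ q ∈ l.tail, c s(v, q) ≠ some b) (hva : Missing c v a)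
    (hz : ¬ (kempeGraph c a b).Reachable z v) :
    l.IsChain (FanRel (kempeSwap c a b z) v) := by
  classical
  refine hch.imp_of_mem_tail fun p _ q hq ⟨x, hx, hpx⟩ => ⟨x, ?_, ?_⟩
  · rw [kempeSwap_of_not_reachable hz, hx]
  · have hxb : x ≠ b := fun h => hb q hq (h ▸ hx)
    have hxa : x ≠ a := fun h => hva q (h ▸ hx)
    by_cases hp : (kempeGraph c a b).Reachable z p
    · rwa [kempeSwap_missing_of_reachable hp, Equiv.swap_apply_of_ne_of_ne hxa hxb]
    · rwa [kempeSwap_missing_of_not_reachable hp]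

/-- Vizing's extension step: if every vertex misses a colour, one more edge can be coloured. -/
theorem IsProperPartial.exists_extension [Fintype V] (hc : IsProperPartial c)
    (hloop : ∀ u, c s(u, u) = none) (hmiss : ∀ u, ∃ x, Missing c u x) {w : V} (hvw : v ≠ w)
    (hw : c s(v, w) = none) :
    ∃ c' : Sym2 V → Option α, IsProperPartial c' ∧
      ∀ e, c' e = none ↔ c e = none ∧ e ≠ s(v, w) := by
  classical
  obtain ⟨a, hva⟩ := hmiss v
  have swapStep : ∀ (l : List V) (b : α), v ∉ w :: l → (w :: l).Nodup →
      (w :: l).IsChain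
        (FanRel (kempeSwap c a b ((w :: l).getLast (List.cons_ne_nil _ _))) v) →
      Missing c ((w :: l).getLast (List.cons_ne_nil _ _)) b →
      ¬ (kempeGraph c a b).Reachable ((w :: l).getLast (List.cons_ne_nil _ _)) v →
      ∃ c' : Sym2 V → Option α, IsProperPartial c' ∧
        ∀ e, c' e = none ↔ c e = none ∧ e ≠ s(v, w) := by
    intro l b hv hnd hch hb hr
    obtain ⟨c', hc', h⟩ := exists_coloring_of_fan (a := a) l w _ (hc.swap (a := a) (b := b)
      (x := (w :: l).getLast (List.cons_ne_nil _ _)))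
      ((kempeSwap_eq_none_iff _).2 hw) hv hnd hch
      ((kempeSwap_missing_of_not_reachable hr _).2 hva)
      ((kempeSwap_missing_of_reachable (SimpleGraph.Reachable.refl _) _).2
        (by rwa [Equiv.swap_apply_left]))
    exact ⟨c', hc', fun e => by rw [h, kempeSwap_eq_none_iff]⟩
  have main : ∀ (n : ℕ) (l : List V), Fintype.card V - l.length = n → v ∉ w :: l →
      (w :: l).Nodup → (w :: l).IsChain (FanRel c v) →
      ∃ c' : Sym2 V → Option α, IsProperPartial c' ∧
        ∀ e, c' e = none ↔ c e = none ∧ e ≠ s(v, w) := by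
    intro n
    induction n with
    | zero =>
      intro l hl _ hnd _
      have := hnd.length_le_card
      rw [List.length_cons] at this
      omega
    | succ n ih =>
      intro l hl hv hnd hch
      set z := (w :: l).getLast (List.cons_ne_nil _ _) with hzdef
      obtain ⟨b, hzb⟩ := hmiss z
      by_cases hvb : Missing c v b
      · exact exists_coloring_of_fan l w c hc hw hv hnd hch hvb hzb
      simp only [Missing, not_forall, not_not] at hvb
      obtain ⟨t, ht⟩ := hvb
      have htw : t ≠ w := by rintro rfl; rw [hw] at ht; cases ht
      by_cases htl : t ∈ w :: l
      -- The predecessor `u` of `t` also misses `b`. Of `v`, `u`, `z`, each an end or isolated in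
      -- the `a`/`b` graph, some `b`-missing one lies outside the component of `v`; a swap there
      -- makes it miss `a`.
      · obtain ⟨l₁, l₂, hl₁₂⟩ := List.append_of_mem htl
        cases l₁ with
        | nil => simp only [List.nil_append, List.cons.injEq] at hl₁₂; exact absurd hl₁₂.1.symm htw
        | cons w' l₁ =>
        have hww : w = w' := by simpa using (List.cons.inj hl₁₂).1
        subst hww
        have hnd₁ := hnd
        have hch₁ := hch
        rw [hl₁₂] at hnd₁ hch₁
        rw [List.isChain_append] at hch₁
        obtain ⟨hchl, hchr, hmid⟩ := hch₁
        set u := (w :: l₁).getLast (List.cons_ne_nil _ _) with hudef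
        have hrel : FanRel c v u t := hmid u (by
          rw [List.getLast?_eq_getLast_of_ne_nil (List.cons_ne_nil _ _)]; simp [hudef]) t (by simp)
        have hub : Missing c u b := by
          obtain ⟨x, hx, hux⟩ := hrel
          rw [ht, Option.some.injEq] at hx
          exact hx ▸ hux
        have hu1 : u ∈ w :: l₁ := List.getLast_mem _
        have hz2 : z ∈ t :: l₂ := by
          have : z = (t :: l₂).getLast (List.cons_ne_nil _ _) := by
            rw [hzdef]
            simp only [hl₁₂]
            rw [List.getLast_append_of_ne_nil]
          rw [this]; exact List.getLast_mem _
        rw [List.nodup_append] at hnd₁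
        obtain ⟨hndl, hndr, hdisj⟩ := hnd₁
        have huz : u ≠ z := hdisj u hu1 z hz2
        have hul : u ∈ w :: l := by rw [hl₁₂]; exact List.mem_append_left _ hu1
        have hzl : z ∈ w :: l := List.getLast_mem _
        have hvu : v ≠ u := by intro h; exact hv (h ▸ hul)
        have hvz : v ≠ z := by intro h; exact hv (h ▸ hzl)
        have hnb1 : ∀ q ∈ (w :: l₁), c s(v, q) ≠ some b := fun q hq hqb =>
          hdisj q hq t (by simp) (hc hqb ht)
        by_cases hru : (kempeGraph c a b).Reachable u v
        · have hrz : ¬ (kempeGraph c a b).Reachable z v := fun hrz =>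
            SimpleGraph.not_reachable_of_degree_le (kempeGraph c a b)
              hc.ncard_kempeGraph_neighborSet_le hvu hvz huz
              (hc.ncard_kempeGraph_neighborSet_le_one (Or.inl hva))
              (hc.ncard_kempeGraph_neighborSet_le_one (Or.inr hub))
              (hc.ncard_kempeGraph_neighborSet_le_one (Or.inr hzb)) hru.symm hrz.symm
          refine swapStep l b hv hnd ?_ hzb hrz
          rw [← hzdef, hl₁₂, List.isChain_append]
          refine ⟨isChain_fanRel_kempeSwap hchl
            (fun q hq => hnb1 q (List.mem_of_mem_tail hq)) hva hrz,
            isChain_fanRel_kempeSwap hchr (fun q hq hqb => ?_) hva hrz, ?_⟩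
          · rw [List.tail_cons] at hq
            exact (List.nodup_cons.1 hndr).1 (hc hqb ht ▸ hq)
          · intro p hp q hq
            rw [List.getLast?_eq_getLast_of_ne_nil (List.cons_ne_nil _ _)] at hp
            simp only [Option.mem_def, Option.some.injEq, List.head?_cons] at hp hq
            subst hq
            rw [← hp]
            refine ⟨b, ?_, ?_⟩
            · rw [kempeSwap_of_not_reachable hrz, ht]
            · exact (kempeSwap_missing_of_not_reachable (fun h => hrz (h.trans hru)) _).2 hub
        -- Here the fan is cut off at `u`, before the edge `vt` of colour `b`.
        · refine swapStep l₁ b (fun h => hv ?_) hndl ?_ hub hru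
          · rw [hl₁₂]; exact List.mem_append_left _ h
          · exact isChain_fanRel_kempeSwap hchl
              (fun q hq => hnb1 q (List.mem_of_mem_tail hq)) hva hru
      · have hvt : v ≠ t := by rintro rfl; rw [hloop] at ht; cases ht
        refine ih (l ++ [t]) ?_ ?_ ?_ ?_
        · rw [List.length_append, List.length_singleton]; omega
        · rw [← List.cons_append, List.mem_append, List.mem_singleton]
          tauto
        · rw [← List.cons_append, List.nodup_append]
          refine ⟨hnd, List.nodup_singleton _, fun p hp q hq => ?_⟩
          rw [List.mem_singleton] at hq
          rintro rfl
          exact htl (hq ▸ hp)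
        · rw [← List.cons_append, List.isChain_append]
          refine ⟨hch, List.isChain_singleton _, fun p hp q hq => ?_⟩
          rw [List.getLast?_eq_getLast_of_ne_nil (List.cons_ne_nil _ _)] at hp
          simp only [Option.mem_def, Option.some.injEq, List.head?_cons] at hp hq
          subst hq
          rw [← hp]
          exact ⟨b, ht, hzb⟩
  exact main _ [] rfl (by simpa using hvw) (by simp) (by simp)

end Fan

/-- **Vizing's theorem**: a graph of maximum degree at most `d` has a proper edge colouring with
`d + 1` colours. -/
theorem SimpleGraph.exists_edgeColoring {V : Type*} [Fintype V] (G : SimpleGraph V) (d : ℕ)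
    (hd : ∀ v, (G.neighborSet v).ncard ≤ d) :
    ∃ c : Sym2 V → Option (Fin (d + 1)), IsProperPartial c ∧ ∀ e, c e ≠ none ↔ e ∈ G.edgeSet := by
  classical
  have key : ∀ s : Finset (Sym2 V), (s : Set (Sym2 V)) ⊆ G.edgeSet →
      ∃ c : Sym2 V → Option (Fin (d + 1)), IsProperPartial c ∧ ∀ e, c e ≠ none ↔ e ∈ s := by
    intro s
    induction s using Finset.induction_on with
    | empty =>
      exact fun _ => ⟨fun _ => none, fun _ _ _ _ h => by simp at h, by simp⟩
    | insert e s he ih =>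
      intro hs
      rw [Finset.coe_insert, Set.insert_subset_iff] at hs
      obtain ⟨c, hc, hcs⟩ := ih hs.2
      have hadj : ∀ {u w}, c s(u, w) ≠ none → G.Adj u w := fun h => hs.2 ((hcs _).1 h)
      induction e with | _ v w
      have hvw : G.Adj v w := hs.1
      obtain ⟨c', hc', h⟩ := hc.exists_extension (v := v) (w := w)
        (fun u => by_contra fun h => (hadj h).ne rfl) (fun u => by
          by_contra hno
          simp only [Missing, not_exists, not_forall, not_not] at hno
          choose g hg using hno
          have hinj : Function.Injective g := fun x y hxy => by
            have := (hg x).symm.trans (hxy ▸ hg y)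
            simpa using this
          have h1 : (Set.range g).ncard ≤ (G.neighborSet u).ncard := by
            refine Set.ncard_le_ncard ?_ (Set.toFinite _)
            rintro _ ⟨x, rfl⟩
            exact hadj (by simp [hg x])
          rw [← Set.image_univ, Set.ncard_image_of_injective _ hinj, Set.ncard_univ,
            Nat.card_eq_fintype_card, Fintype.card_fin] at h1
          have := hd u
          omega) hvw.ne (by_contra fun h => he ((hcs _).1 h))
      refine ⟨c', hc', fun f => ?_⟩
      rw [Ne, h, Finset.mem_insert, ← hcs]
      tauto
  obtain ⟨c, hc, h⟩ := key G.edgeFinset (by simp)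
  exact ⟨c, hc, fun e => by rw [h, SimpleGraph.mem_edgeFinset]⟩

/-! ### Contraction of heavy matchings. -/

/-- The map `f` identifies the ends of `e`. -/
def Contracts {V W : Type*} (f : V → W) (e : Sym2 V) : Prop := (e.map f).IsDiag

theorem contracts_mk {V W : Type*} {f : V → W} {u v : V} : Contracts f s(u, v) ↔ f u = f v := by
  rw [Contracts, Sym2.map_mk, Sym2.mk_isDiag_iff]

/-- The loopless image of `G` under `f`. -/
def SimpleGraph.contraction {V W : Type*} (G : SimpleGraph V) (f : V → W) : SimpleGraph W :=
  SimpleGraph.fromEdgeSet (Sym2.map f '' G.edgeSet)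

theorem SimpleGraph.mem_edgeSet_contraction {V W : Type*} {G : SimpleGraph V} {f : V → W}
    {q : Sym2 W} :
    q ∈ (G.contraction f).edgeSet ↔ (∃ e ∈ G.edgeSet, e.map f = q) ∧ ¬ q.IsDiag := by
  rw [SimpleGraph.contraction, SimpleGraph.edgeSet_fromEdgeSet]
  rfl

open Classical in
/-- Contracting a heavy matching: `f` identifies exactly the ends of the edges of a matching that
carries at least the fraction `1 / (d + 1)` of the weight. -/
theorem SimpleGraph.exists_matching_contraction {W : Type*} [Fintype W] (H : SimpleGraph W) (d : ℕ)
    (hd : ∀ v, (H.neighborSet v).ncard ≤ d) (ω : Sym2 W → ℝ) :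
    ∃ f : W → Sym2 W, (∀ u v, u ≠ v → f u = f v → f u = s(u, v) ∧ H.Adj u v) ∧
      ∑ e ∈ H.edgeFinset, ω e
        ≤ (d + 1) * ∑ e ∈ H.edgeFinset with Contracts f e, ω e := by
  obtain ⟨c, hc, hsupp⟩ := H.exists_edgeColoring d hd
  obtain ⟨x, hx⟩ : ∃ x : Fin (d + 1), ∑ e ∈ H.edgeFinset, ω e
      ≤ (d + 1) * ∑ e ∈ H.edgeFinset with c e = some x, ω e := by
    by_contra! hlt
    have hsum : ∑ x : Fin (d + 1), ∑ e ∈ H.edgeFinset with c e = some x, ω e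
        = ∑ e ∈ H.edgeFinset, ω e := by
      simp_rw [Finset.sum_filter]
      rw [Finset.sum_comm]
      refine Finset.sum_congr rfl fun e he => ?_
      obtain ⟨y, hy⟩ := Option.ne_none_iff_exists'.1 ((hsupp e).2 (by simpa using he))
      simp [hy]
    have := Finset.sum_lt_sum_of_nonempty (Finset.univ_nonempty (α := Fin (d + 1)))
      fun x _ => hlt x
    rw [← Finset.mul_sum, hsum, Finset.sum_const, Finset.card_univ, Fintype.card_fin,
      nsmul_eq_mul] at this
    push_cast at this
    exact lt_irrefl _ this
  -- A matched vertex is labelled by its matching edge, an unmatched one by its diagonal pair.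
  let f : W → Sym2 W := fun v => if h : ∃ u, c s(v, u) = some x then s(v, h.choose) else s(v, v)
  have hf : ∀ {u v}, c s(u, v) = some x → f u = s(u, v) := by
    intro u v h
    have hex : ∃ v, c s(u, v) = some x := ⟨v, h⟩
    simp only [f, dif_pos hex]
    rw [hc hex.choose_spec h]
  have hmem : ∀ u, u ∈ f u := by
    intro u
    simp only [f]
    split_ifs <;> simp
  have hf' : ∀ {u v}, u ≠ v → f u = f v → c s(u, v) = some x := by
    intro u v huv h
    have hv : v ∈ f u := h ▸ hmem v
    by_cases hex : ∃ v, c s(u, v) = some x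
    · obtain ⟨t, ht⟩ := hex
      rw [hf ht, Sym2.mem_iff] at hv
      rcases hv with rfl | rfl
      · exact absurd rfl huv
      · exact ht
    · simp only [f, dif_neg hex, Sym2.mem_iff, or_self] at hv
      exact absurd hv.symm huv
  refine ⟨f, fun u v huv h => ⟨hf (hf' huv h), ?_⟩, ?_⟩
  · exact (hsupp s(u, v)).1 (by simp [hf' huv h])
  · convert hx using 3
    refine Finset.filter_congr fun e he => ?_
    induction e with | _ u v
    have huv : H.Adj u v := by simpa using he
    rw [contracts_mk]
    refine ⟨fun h => hf' huv.ne h, fun h => ?_⟩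
    rw [hf h, Sym2.eq_swap, hf (by rwa [Sym2.eq_swap])]

/-! ### Random flips, bipartite parts and the numerical bound. -/

namespace WeightedCut

variable {V : Type*} [Fintype V]

open Classical in
/-- If every part of a vertex partition induces a bipartite graph, then some cut contains all
edges inside the parts and half of the weight of the other edges. -/
theorem weight_add_inside_le_two_mul_mac {ι : Type*} [Fintype ι] (G : SimpleGraph V)
    (w : Sym2 V → ℝ) (p : V → ι) (s : V → Bool)
    (hs : ∀ u v, G.Adj u v → p u = p v → s u ≠ s v) :
    weight w G + ∑ e ∈ G.edgeFinset with Contracts p e, w e ≤ 2 * mac G w := by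
  let A : (ι → Bool) → Finset V := fun σ => Finset.univ.filter fun v => (s v ^^ σ (p v)) = true
  let g : (ι → Bool) → V → ℝ := fun σ v => if (s v ^^ σ (p v)) = true then 1 else -1
  -- The sign is `1` on cut edges and `-1` on the others.
  let ε : (ι → Bool) → Sym2 V → ℝ := fun σ =>
    Sym2.lift ⟨fun u v => - (g σ u * g σ v), fun u v => by simp only [mul_comm]⟩
  have hcut : ∀ σ, 2 * weight w (cut G (A σ : Set V)) = ∑ e ∈ G.edgeFinset, (1 + ε σ e) * w e := by
    intro σ
    have hsub : (cut G (A σ : Set V)).edgeFinset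
        = G.edgeFinset.filter (fun e => e ∈ (cut G (A σ : Set V)).edgeSet) := by
      ext e
      induction e with | _ u v
      rw [Finset.mem_filter, SimpleGraph.mem_edgeFinset, SimpleGraph.mem_edgeFinset]
      exact ⟨fun h => ⟨h.1, h⟩, fun h => h.2⟩
    rw [weight, hsub, Finset.sum_filter, Finset.mul_sum]
    refine Finset.sum_congr rfl fun e he => ?_
    induction e with | _ u v
    have huv : G.Adj u v := by simpa using he
    simp only [SimpleGraph.mem_edgeSet, cut, SimpleGraph.between_adj, huv, true_and, A, ε, g,
      Sym2.lift_mk, Finset.coe_filter, Finset.mem_univ, Set.mem_ofPred_eq, Set.mem_compl_iff]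
    cases (s u ^^ σ (p u)) <;> cases (s v ^^ σ (p v)) <;> norm_num
  have hε : ∀ e ∈ G.edgeFinset, ∑ σ, ε σ e
      = if Contracts p e then (Fintype.card (ι → Bool) : ℝ) else 0 := by
    intro e he
    induction e with | _ u v
    have huv : G.Adj u v := by simpa using he
    simp only [contracts_mk]
    split_ifs with h
    · have hone : ∀ σ, ε σ s(u, v) = 1 := by
        intro σ
        have := hs u v huv h
        simp only [ε, g, Sym2.lift_mk, h]
        revert this
        cases s u <;> cases s v <;> cases σ (p v) <;> norm_num
      simp [hone]
    -- Flipping only the part of `u` reverses the sign of an edge between parts, so the terms cancel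
    -- in pairs.
    · refine Finset.sum_involution (fun σ _ => Function.update σ (p u) (!(σ (p u)))) ?_ ?_ ?_ ?_
      · intro σ _
        simp only [ε, g, Sym2.lift_mk, Function.update_self, Function.update_of_ne (Ne.symm h)]
        cases s u <;> cases σ (p u) <;> cases s v <;> cases σ (p v) <;> simp
      · intro σ _ _ heq
        have := congrFun heq (p u)
        simp at this
      · simp
      · intro σ _
        simp
  have hmac : ∀ σ, 2 * weight w (cut G (A σ : Set V)) ≤ 2 * mac G w := fun σ => by
    have := Finset.le_sup' (fun B : Finset V => weight w (cut G (B : Set V)))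
      (Finset.mem_univ (A σ))
    exact mul_le_mul_of_nonneg_left this (by norm_num)
  have hsum := Finset.sum_le_sum (s := Finset.univ) fun σ _ => hmac σ
  have hcalc : ∑ σ, 2 * weight w (cut G (A σ : Set V)) = (Fintype.card (ι → Bool) : ℝ) *
      (weight w G + ∑ e ∈ G.edgeFinset with Contracts p e, w e) := by
    simp_rw [hcut]
    rw [Finset.sum_comm, weight, Finset.sum_filter, ← Finset.sum_add_distrib, Finset.mul_sum]
    refine Finset.sum_congr rfl fun e he => ?_
    rw [← Finset.sum_mul, Finset.sum_add_distrib, hε e he]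
    split_ifs
    · simp; ring
    · simp
  rw [hcalc, Finset.sum_const, Finset.card_univ, nsmul_eq_mul] at hsum
  exact le_of_mul_le_mul_left hsum (by exact_mod_cast Fintype.card_pos)

open Classical in
/-- The weight of the edges of `G` that `f` maps to `q`. -/
noncomputable def pushWeight {W : Type*} (G : SimpleGraph V) (w : Sym2 V → ℝ) (f : V → W)
    (q : Sym2 W) : ℝ :=
  ∑ e ∈ G.edgeFinset with e.map f = q, w e

-- With `P` always true this is the weight outside the first matching; with `P = Contracts g` it is
-- the weight gained by the second.
open Classical in
theorem sum_pushWeight {W : Type*} [Fintype W] (G : SimpleGraph V) (w : Sym2 V → ℝ) (f : V → W)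
    (P : Sym2 W → Prop) :
    ∑ q ∈ (G.contraction f).edgeFinset with P q, pushWeight G w f q
      = ∑ e ∈ G.edgeFinset with ¬ Contracts f e ∧ P (e.map f), w e := by
  unfold pushWeight
  rw [← Finset.sum_fiberwise_of_maps_to (s := G.edgeFinset.filter _) (g := Sym2.map f)
    (t := (G.contraction f).edgeFinset.filter P)]
  · refine Finset.sum_congr rfl fun q hq => Finset.sum_congr ?_ fun _ _ => rfl
    rw [Finset.mem_filter, SimpleGraph.mem_edgeFinset,
      SimpleGraph.mem_edgeSet_contraction] at hq
    ext e
    simp only [Finset.mem_filter]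
    refine ⟨fun ⟨h1, h2⟩ => ⟨⟨h1, ?_, ?_⟩, h2⟩, fun h => ⟨h.1.1, h.2⟩⟩
    · rw [Contracts, h2]; exact hq.1.2
    · rw [h2]; exact hq.2
  · intro e he
    rw [Finset.mem_filter] at he
    rw [Finset.mem_filter, SimpleGraph.mem_edgeFinset, SimpleGraph.mem_edgeSet_contraction]
    exact ⟨⟨⟨e, by simpa using he.1, rfl⟩, he.2.1⟩, he.2.2⟩

/-- Contracting a matching gives a graph of maximum degree at most `2 * Δ - 2`. -/
theorem ncard_neighborSet_contraction_le (G : SimpleGraph V) {Δ : ℕ} (hΔ2 : 2 ≤ Δ)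
    (hΔ : ∀ v, (G.neighborSet v).ncard ≤ Δ) {f : V → Sym2 V}
    (hf : ∀ u v, u ≠ v → f u = f v → f u = s(u, v) ∧ G.Adj u v) (q : Sym2 V) :
    ((G.contraction f).neighborSet q).ncard ≤ 2 * Δ - 2 := by
  classical
  have hnb : ∀ r ∈ (G.contraction f).neighborSet q,
      ∃ x y, G.Adj x y ∧ f x = q ∧ f y = r ∧ q ≠ r := by
    intro r hr
    obtain ⟨⟨e, he, heq⟩, hne⟩ := SimpleGraph.mem_edgeSet_contraction.1
      ((SimpleGraph.mem_edgeSet _).2 hr)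
    rw [Sym2.mk_isDiag_iff] at hne
    induction e with | _ x y
    rw [Sym2.map_mk] at heq
    rcases Sym2.eq_iff.1 heq with ⟨h1, h2⟩ | ⟨h1, h2⟩
    · exact ⟨x, y, he, h1, h2, hne⟩
    · exact ⟨y, x, SimpleGraph.Adj.symm he, h2, h1, hne⟩
  by_cases hq : ∃ u, f u = q
  · obtain ⟨u, rfl⟩ := hq
    by_cases hu : ∃ u', u ≠ u' ∧ f u = f u'
    · obtain ⟨u', hne, huu'⟩ := hu
      obtain ⟨hfu, hadj⟩ := hf u u' hne huu'
      have hsub : (G.contraction f).neighborSet (f u)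
          ⊆ f '' ((G.neighborSet u \ {u'}) ∪ (G.neighborSet u' \ {u})) := by
        intro r hr
        obtain ⟨x, y, hxy, hx, rfl, hne'⟩ := hnb r hr
        refine ⟨y, ?_, rfl⟩
        have hyu : y ≠ u := by rintro rfl; exact hne' rfl
        have hyu' : y ≠ u' := by rintro rfl; exact hne' huu'
        by_cases hxu : x = u
        · subst hxu; exact Or.inl ⟨hxy, hyu'⟩
        · have := (hf u x (Ne.symm hxu) hx.symm).1
          rw [hfu] at this
          have := Sym2.congr_right.1 this
          subst this
          exact Or.inr ⟨hxy, hyu⟩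
      have h1 := Set.ncard_sdiff_singleton_of_mem (s := G.neighborSet u) (a := u') hadj
      have h2 := Set.ncard_sdiff_singleton_of_mem (s := G.neighborSet u') (a := u) hadj.symm
      have h3 := Set.ncard_le_ncard hsub (Set.toFinite _)
      have h4 := Set.ncard_image_le (f := f)
        (Set.toFinite ((G.neighborSet u \ {u'}) ∪ (G.neighborSet u' \ {u})))
      have h5 := Set.ncard_union_le (G.neighborSet u \ {u'}) (G.neighborSet u' \ {u})
      have h6 := hΔ u
      have h7 := hΔ u'
      omega
    -- An unmatched vertex keeps degree at most `Δ`, and `Δ ≤ 2Δ - 2` because `Δ ≥ 2`.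
    · push Not at hu
      have hsub : (G.contraction f).neighborSet (f u)
          ⊆ f '' G.neighborSet u := by
        intro r hr
        obtain ⟨x, y, hxy, hx, rfl, -⟩ := hnb r hr
        have hxu : u = x := by_contra fun h => hu x h hx.symm
        subst hxu
        exact ⟨y, hxy, rfl⟩
      have h3 := Set.ncard_le_ncard hsub (Set.toFinite _)
      have h4 := Set.ncard_image_le (f := f) (Set.toFinite (G.neighborSet u))
      have h6 := hΔ u
      omega
  · have : (G.contraction f).neighborSet q = ∅ := by
      rw [Set.eq_empty_iff_forall_notMem]
      intro r hr
      obtain ⟨x, -, -, hx, -⟩ := hnb r hr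
      exact hq ⟨x, hx⟩
    simp [this]

-- Fibres have at most two elements, and `Quot.out` singles out one end of each pair.
open Classical in
theorem exists_bool_of_contraction {W : Type*} {f : W → Sym2 W}
    (hf : ∀ u v, u ≠ v → f u = f v → f u = s(u, v)) :
    ∃ s : W → Bool, ∀ u v, u ≠ v → f u = f v → s u ≠ s v := by
  refine ⟨fun v => decide ((f v).out.1 = v), fun u v huv h => ?_⟩
  have h1 := Sym2.out_fst_mem (f v)
  rw [← h, hf u v huv h, Sym2.mem_iff] at h1
  simp only [← h]
  rw [hf u v huv h]
  rcases h1 with h1 | h1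
  · simp [h1, huv]
  · simp [h1, huv.symm]

open Classical in
/-- In a triangle-free graph, two successive matching contractions have bipartite fibres. -/
theorem exists_bool_of_two_contractions {V : Type*} (G : SimpleGraph V) (hG : G.CliqueFree 3)
    {f : V → Sym2 V} (hf : ∀ u v, u ≠ v → f u = f v → f u = s(u, v) ∧ G.Adj u v)
    {g : Sym2 V → Sym2 (Sym2 V)} (hg : ∀ q r, q ≠ r → g q = g r → g q = s(q, r)) :
    ∃ s : V → Bool, ∀ u v, G.Adj u v → g (f u) = g (f v) → s u ≠ s v := by
  obtain ⟨s, hs⟩ := exists_bool_of_contraction fun u v h1 h2 => (hf u v h1 h2).1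
  have htri : ∀ {x y z}, G.Adj x y → G.Adj y z → G.Adj x z → False := fun h1 h2 h3 =>
    hG _ (SimpleGraph.is3Clique_triple_iff.2 ⟨h1, h3, h2⟩)
  -- Two edges between the same two classes cannot share an end without closing a triangle. So they
  -- are disjoint, and `s` changes at both ends.
  have hcons : ∀ {u v u' v'}, G.Adj u v → G.Adj u' v' → f u' = f u → f v' = f v →
      s u' = s v' → s u = s v := by
    intro u v u' v' h h' hu hv hss
    by_cases huu : u' = u
    · subst huu
      by_cases hvv : v' = v
      · rw [← hvv]; exact hss
      · exact (htri h' (hf _ _ hvv hv).2 h).elim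
    · by_cases hvv : v' = v
      · subst hvv
        exact (htri (hf _ _ huu hu).2 h h').elim
      · have h1 := hs _ _ huu hu
        have h2 := hs _ _ hvv hv
        revert hss h1 h2
        cases s u <;> cases s v <;> cases s u' <;> cases s v' <;> simp
  -- By `hcons` the cross edges of a pair of classes are all monochromatic or all bichromatic under
  -- `s`. In the former case exactly one class, the chosen representative, is flipped.
  let flip : Sym2 V → Prop := fun q => (g q).out.1 = q ∧
    ∃ u v, G.Adj u v ∧ f u = q ∧ f v ≠ q ∧ g (f v) = g q ∧ s u = s v
  have key : ∀ {u v}, G.Adj u v → f u ≠ f v → g (f u) = g (f v) → (g (f u)).out.1 = f u →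
      (s u ^^ decide (flip (f u))) ≠ (s v ^^ decide (flip (f v))) := by
    intro u v huv hne hgg hout
    have hv : ¬ flip (f v) := by
      rintro ⟨h, -⟩
      rw [← hgg, hout] at h
      exact hne h
    have hu : flip (f u) ↔ s u = s v := by
      refine ⟨fun ⟨_, u', v', h', hu', hv', hgv', hss⟩ => ?_,
        fun h => ⟨hout, u, v, huv, rfl, hne.symm, hgg.symm, h⟩⟩
      refine hcons huv h' hu' ?_ hss
      have h1 := hg _ _ hv'.symm hgv'.symm
      rw [hg _ _ hne hgg] at h1
      exact (Sym2.congr_right.1 h1).symm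
    simp only [hv, hu]
    cases s u <;> cases s v <;> simp
  refine ⟨fun v => s v ^^ decide (flip (f v)), fun u v huv hgg => ?_⟩
  by_cases hff : f u = f v
  · have := hs u v huv.ne hff
    simp only [hff]
    intro h
    exact this (by simpa using h)
  · have h1 := Sym2.out_fst_mem (g (f u))
    have h2 : (g (f u)).out.1 ∈ s(f u, f v) := hg _ _ hff hgg ▸ h1
    rcases Sym2.mem_iff.1 h2 with h1 | h1
    · exact key huv hff hgg h1
    · exact (key huv.symm (Ne.symm hff) hgg.symm (hgg ▸ h1)).symm

open Classical in
theorem mac_ge_of_two_le (G : SimpleGraph V) (w : Sym2 V → ℝ) (hG : G.CliqueFree 3) {Δ : ℕ}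
    (hΔ2 : 2 ≤ Δ) (hΔ : ∀ v, (G.neighborSet v).ncard ≤ Δ) :
    (1 + (3 * (Δ : ℝ) - 1) / ((2 * Δ - 1) * (Δ + 1))) * weight w G ≤ 2 * mac G w := by
  obtain ⟨f, hf, hfw⟩ := G.exists_matching_contraction Δ hΔ w
  obtain ⟨g, hg, hgw⟩ := (G.contraction f).exists_matching_contraction (2 * Δ - 2)
    (ncard_neighborSet_contraction_le G hΔ2 hΔ hf) (pushWeight G w f)
  obtain ⟨s, hs⟩ := exists_bool_of_two_contractions G hG hf fun q r h1 h2 => (hg q r h1 h2).1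
  have hmac := weight_add_inside_le_two_mul_mac G w (g ∘ f) s hs
  have h1 := sum_pushWeight G w f fun _ => True
  have h2 := sum_pushWeight G w f (Contracts g)
  simp only [and_true, Finset.filter_true] at h1
  have h3 := Finset.sum_filter_add_sum_filter_not G.edgeFinset (fun e => Contracts f e) w
  have h4 : ∑ e ∈ G.edgeFinset with Contracts (g ∘ f) e, w e
      = ∑ e ∈ G.edgeFinset with Contracts f e, w e
        + ∑ e ∈ G.edgeFinset with ¬ Contracts f e ∧ Contracts g (e.map f), w e := by
    rw [← Finset.sum_filter_add_sum_filter_not (G.edgeFinset.filter _)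
      (fun e => Contracts f e) w, Finset.filter_filter, Finset.filter_filter]
    congr 1
    · refine Finset.sum_congr (Finset.filter_congr fun e _ => ?_) fun _ _ => rfl
      induction e with | _ x y
      simp only [contracts_mk, Function.comp_apply]
      exact ⟨fun h => h.2, fun h => ⟨by rw [h], h⟩⟩
    · refine Finset.sum_congr (Finset.filter_congr fun e _ => ?_) fun _ _ => rfl
      rw [Contracts, Contracts, Contracts, Sym2.map_map, and_comm]
  rw [h1, h2] at hgw
  rw [h4] at hmac
  have hcast : ((2 * Δ - 2 : ℕ) : ℝ) + 1 = 2 * Δ - 1 := by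
    rw [Nat.cast_sub (by omega)]; push_cast; ring
  rw [hcast] at hgw
  have hΔ2' : (2 : ℝ) ≤ Δ := by exact_mod_cast hΔ2
  change weight w G ≤ _ at hfw
  change _ = weight w G at h3
  generalize weight w G = T at *
  generalize ∑ e ∈ G.edgeFinset with Contracts f e, w e = M at *
  generalize ∑ e ∈ G.edgeFinset with ¬ Contracts f e, w e = R at *
  generalize ∑ e ∈ G.edgeFinset with ¬ Contracts f e ∧ Contracts g (e.map f), w e = N at *
  refine le_trans ?_ hmac
  have hpos : (0 : ℝ) < (2 * Δ - 1) * (Δ + 1) := by nlinarith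
  have hfrac : (3 * (Δ : ℝ) - 1) / ((2 * Δ - 1) * (Δ + 1)) * T ≤ M + N := by
    -- Add `Δ + 1` times `T - M ≤ (2Δ - 1) N` to `2Δ - 2` times `T ≤ (Δ + 1) M`.
    rw [div_mul_eq_mul_div, div_le_iff₀ hpos]
    nlinarith [mul_le_mul_of_nonneg_left hgw (by linarith : (0 : ℝ) ≤ Δ + 1),
      mul_le_mul_of_nonneg_left hfw (by linarith : (0 : ℝ) ≤ 2 * Δ - 2)]
  linarith

open Classical in
theorem weight_le_mac_of_ncard_neighborSet_le_one (G : SimpleGraph V) (w : Sym2 V → ℝ)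
    (hΔ : ∀ v, (G.neighborSet v).ncard ≤ 1) : weight w G ≤ mac G w := by
  have huniq : ∀ {u v v'}, G.Adj u v → G.Adj u v' → v = v' := fun {u v v'} h h' =>
    Set.ncard_le_one_iff_subsingleton.1 (hΔ u) h h'
  let f : V → Sym2 V := fun v => if h : ∃ u, G.Adj v u then s(v, h.choose) else s(v, v)
  have hf : ∀ {u v}, G.Adj u v → f u = s(u, v) := by
    intro u v h
    have hex : ∃ v, G.Adj u v := ⟨v, h⟩
    simp only [f, dif_pos hex]
    rw [huniq hex.choose_spec h]
  have hmem : ∀ u, u ∈ f u := by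
    intro u
    simp only [f]
    split_ifs <;> simp
  obtain ⟨s, hs⟩ := exists_bool_of_contraction (f := f) fun u v huv h => by
    have h1 := hmem u
    have h2 := hmem v
    rw [← h] at h2
    exact (Sym2.mem_and_mem_iff huv).1 ⟨h1, h2⟩
  have h := weight_add_inside_le_two_mul_mac G w f s fun u v huv h => hs u v huv.ne h
  rw [Finset.filter_true_of_mem] at h
  · change weight w G + weight w G ≤ _ at h
    linarith
  · intro e he
    induction e with | _ u v
    have huv : G.Adj u v := by simpa using he
    rw [contracts_mk, hf huv, hf huv.symm, Sym2.eq_swap]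

end WeightedCut

theorem mainTheorem3 {V : Type*} [Fintype V] (G : SimpleGraph V) [DecidableRel G.Adj]
    (w : Sym2 V → ℝ) (hw : ∀ e ∈ G.edgeSet, 0 ≤ w e)
    (hG : G.CliqueFree 3) (Δ : ℕ) (hΔ : G.maxDegree ≤ Δ) :
    (1 / 2 + (3 * (Δ : ℝ) - 1) / (4 * (Δ : ℝ) ^ 2 + 2 * (Δ : ℝ) - 2)) * WeightedCut.weight w G
      ≤ WeightedCut.mac G w := by
  have hdeg : ∀ v, (G.neighborSet v).ncard ≤ Δ := fun v => by
    rw [← SimpleGraph.coe_neighborFinset, Set.ncard_coe_finset]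
    exact (G.degree_le_maxDegree v).trans hΔ
  rcases Nat.lt_or_ge Δ 2 with hlt | hge
  · have h1 := WeightedCut.weight_le_mac_of_ncard_neighborSet_le_one G w
      fun v => (hdeg v).trans (by omega)
    -- Both `t_0` and `t_1` equal 1, and a graph of maximum degree at most one is itself a cut.
    interval_cases Δ <;> norm_num <;> linarith
  · have h := WeightedCut.mac_ge_of_two_le G w hG hge hdeg
    have hge' : (2 : ℝ) ≤ Δ := by exact_mod_cast hge
    have hfac : (4 * (Δ : ℝ) ^ 2 + 2 * Δ - 2) = 2 * ((2 * Δ - 1) * (Δ + 1)) := by ring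
    rw [hfac, mul_comm (2 : ℝ), ← div_div]
    linarith
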